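/- Let $m\ge 1$ and let $\mathrm{Cl}_m$ be the real Clifford algebra generated by $e_1,\dots,e_m$ with $e_ie_j+e_je_i=-2\delta_{ij}$, with the norm $|x|=(\sum_A x_A^2)^{1/2}$ for $x=\sum_A x_Ae_A$. Identify $\mathbb R^{m+1}=\mathbb R\oplus\mathbb R^m$ with the paravectors $x=x_0+\underline x\in\mathrm{Cl}_m$, $\underline x=\sum_{j=1}^m x_je_j$, and put $\operatorname{Re}[x]=x_0$, $\bar x=x_0-\underline x$, and $\mathbb S=\{\underline x:|\underline x|=1\}$. Let $D\subset\mathbb C$ be open and invariant under complex conjugation, and put $\Omega_D=\{u+Jv: u+iv\in D,\ J\in\mathbb S\}$. A stem function on $D$ is a function $F=F_1+iF_2:D\to \mathrm{Cl}_m\otimes\mathbb C$, with $F_1,F_2$ valued in $\mathrm{Cl}_m$, such that $F_1(\bar z)=F_1(z)$ and $F_2(\bar z)=-F_2(z)$. It induces the slice function $f:\Omega_D\to\mathrm{Cl}_m$, $f(u+Jv)=F_1(u+iv)+JF_2(u+iv)$ for $u+iv\in D$, $J\in\mathbb S$. Let $\mathcal S(\Omega_D)$ be the set of slice functions on $\Omega_D$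 and $\mathcal L^p(\Omega_D)=\mathcal S(\Omega_D)\cap L^p(\Omega_D)$, that is, the space of classes in $L^p(\Omega_D)$ ($\mathrm{Cl}_m$-valued, Lebesgue measure $dV$) that contain a slice function, with the $L^p$ norm. Let $\omega_{m-1}$ be the area of $\mathbb S$ (so $\omega_0=2$), and put $$S^{-1}(q,x)=-(q^2-2\operatorname{Re}[x]q+|x|^2)^{-1}(q-\bar x),\qquad K(q,x)=\frac{2\,S^{-1}(q,x)}{\omega_{m-1}|\underline x|^{m-1}},$$ $$T_{\Omega_D}f(q)=-\frac1{2\pi}\int_{\Omega_D}K(q,x)f(x)\,dV(x).$$ Suppose that $\Omega_D$ is bounded, that $\Omega_D\subset\mathbb R^{m+1}\setminus\mathbb R$, and that $\max\{m,2\}<p<\infty$. Then: 1. For each $x\in\Omega_D$, the function $$F(z,x)=F_1(z,x)+iF_2(z,x)=-(z^2-2\operatorname{Re}[x]z+|x|^2)^{-1}(z-\bar x)\in \mathrm{Cl}_m\otimes\mathbb C$$ of $z\in D$ with $z^2-2\operatorname{Re}[x]z+|x|^2\ne0$ is a stem function, and it induces $S^{-1}(\cdot,x)$. 2. For each $f\in\mathcal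 L^p(\Omega_D)$, the integral defining $T_{\Omega_D}f(q)$ converges absolutely for every $q\in\Omega_D$, the integrals in $$H_k(z)=-\frac1{\pi\,\omega_{m-1}}\int_{\Omega_D}\frac{F_k(z,x)}{|\underline x|^{m-1}}f(x)\,dV(x)\qquad(k=1,2)$$ converge absolutely for every $z\in D$, $H=H_1+iH_2$ is a stem function on $D$, and $H$ induces $T_{\Omega_D}f$ (at every point of $\Omega_D$). In particular $T_{\Omega_D}f$ is a slice function. 3. $T_{\Omega_D}$ is a continuous ($\mathbb R$-linear) map of $\mathcal L^p(\Omega_D)$ to itself. -/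

import Mathlib

open MeasureTheory Set
open scoped ENNReal

noncomputable section

namespace SliceClifford

/-! ### The real Clifford algebra with its Euclidean norm -/

/-- The Euclidean space `ℝ^m` of `1`-vectors. -/
abbrev Vec (m : ℕ) : Type := EuclideanSpace ℝ (Fin m)

/-- The negative definite form `v ↦ -|v|²` on `ℝ^m`. -/
def negForm (m : ℕ) : QuadraticForm ℝ (Vec m) :=
  -(LinearMap.BilinMap.toQuadraticMap (innerₗ (Vec m)))

theorem negForm_apply {m : ℕ} (v : Vec m) : negForm m v = -‖v‖ ^ 2 := by
  simp [negForm]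

/-- The real Clifford algebra with generators `e_1, …, e_m` and relations
`e_i e_j + e_j e_i = -2 δ_ij`. -/
abbrev Cl (m : ℕ) : Type := CliffordAlgebra (negForm m)

/-- The inclusion of `1`-vectors into the Clifford algebra. -/
abbrev vec {m : ℕ} : Vec m →ₗ[ℝ] Cl m := CliffordAlgebra.ι (negForm m)

/-- The generator `e_i`. -/
def gen {m : ℕ} (i : Fin m) : Cl m := vec (EuclideanSpace.basisFun (Fin m) ℝ i)

theorem gen_mul_gen_add {m : ℕ} (i j : Fin m) :
    (gen i * gen j + gen j * gen i : Cl m) =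
      algebraMap ℝ (Cl m) (-2 * if i = j then 1 else 0) := by
  have h := CliffordAlgebra.ι_mul_ι_add_swap (Q := negForm m)
    (EuclideanSpace.basisFun (Fin m) ℝ i) (EuclideanSpace.basisFun (Fin m) ℝ j)
  refine h.trans (congrArg _ ?_)
  have hij := (EuclideanSpace.basisFun (Fin m) ℝ).inner_eq_ite i j
  have hji := (EuclideanSpace.basisFun (Fin m) ℝ).inner_eq_ite j i
  simp only [QuadraticMap.polar, negForm_apply, norm_add_sq_real, hij]
  ring

/-- The basis `(e_A)` of the Clifford algebra, indexed by the subsets `A` of `{1, …, m}`: it is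
the image of the basis of the exterior algebra, and `basis_apply` identifies its members with the
ordered products of generators. -/
def basis (m : ℕ) : Module.Basis (Finset (Fin m)) ℝ (Cl m) :=
  (Module.Basis.ExteriorAlgebra (EuclideanSpace.basisFun (Fin m) ℝ).toBasis).map
    (CliffordAlgebra.equivExterior (negForm m)).symm

theorem contractLeft_prod_eq_zero {m : ℕ} {Q : QuadraticForm ℝ (Vec m)}
    (d : Module.Dual ℝ (Vec m)) (l : List (Vec m)) (h : ∀ v ∈ l, d v = 0) :
    CliffordAlgebra.contractLeft (Q := Q) d (l.map (CliffordAlgebra.ι Q)).prod = 0 := by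
  induction l with
  | nil => simp
  | cons a l ih =>
    rw [List.map_cons, List.prod_cons, CliffordAlgebra.contractLeft_ι_mul,
      ih fun v hv => h v (List.mem_cons_of_mem _ hv), h a List.mem_cons_self]
    simp

theorem changeForm_prod {m : ℕ} {Q Q' : QuadraticForm ℝ (Vec m)}
    {B : LinearMap.BilinForm ℝ (Vec m)} (hB : B.toQuadraticMap = Q' - Q) (l : List (Vec m))
    (h : l.Pairwise fun v w => B v w = 0) :
    CliffordAlgebra.changeForm hB (l.map (CliffordAlgebra.ι Q)).prod =
      (l.map (CliffordAlgebra.ι Q')).prod := by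
  induction l with
  | nil => simp
  | cons a l ih =>
    rw [List.pairwise_cons] at h
    rw [List.map_cons, List.prod_cons, CliffordAlgebra.changeForm_ι_mul, ih h.2,
      contractLeft_prod_eq_zero _ _ h.1]
    simp

/-- `e_A = e_{i_1} ⋯ e_{i_k}` for `A = {i_1 < ⋯ < i_k}`. -/
theorem basis_apply {m : ℕ} (A : Finset (Fin m)) :
    basis m A = ((A.sort (· ≤ ·)).map gen).prod := by
  have h1 : Module.Basis.ExteriorAlgebra (EuclideanSpace.basisFun (Fin m) ℝ).toBasis A =
      (((A.sort (· ≤ ·)).map (EuclideanSpace.basisFun (Fin m) ℝ)).map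
        (CliffordAlgebra.ι (0 : QuadraticForm ℝ (Vec m)))).prod := by
    rw [ExteriorAlgebra.basis_apply_ofCard (n := A.card) _ rfl, ExteriorAlgebra.ιMulti_family,
      ExteriorAlgebra.ιMulti_apply, List.map_map]
    congr 1
    refine List.ext_getElem (by simp) fun i h1 h2 => ?_
    simp [Set.powersetCard.ofFinEmbEquiv_symm_apply, Finset.orderEmbOfFin_apply]
  rw [basis, Module.Basis.map_apply, h1, CliffordAlgebra.equivExterior,
    CliffordAlgebra.changeFormEquiv_symm, CliffordAlgebra.changeFormEquiv_apply,
    changeForm_prod]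
  · rw [List.map_map]; rfl
  · rw [List.pairwise_map]
    refine (Finset.sort_nodup A (· ≤ ·)).imp fun {i j} hij => ?_
    have h := (EuclideanSpace.basisFun (Fin m) ℝ).inner_eq_zero hij
    simp only [neg_neg, negForm, LinearMap.neg_apply, QuadraticMap.associated_apply,
      LinearMap.BilinMap.toQuadraticMap_apply, innerₗ_apply_apply, real_inner_self_eq_norm_sq,
      norm_add_sq_real, h]
    have h0 (a b : ℝ) : a + 2 * 0 + b - a - b = 0 := by ring
    rw [h0, smul_zero, neg_zero]

/-- The coordinates `(x_A)` of a Clifford number, as a point of Euclidean space. -/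
def coords (m : ℕ) : Cl m →ₗ[ℝ] EuclideanSpace ℝ (Finset (Fin m)) :=
  ((basis m).equivFun.trans (WithLp.linearEquiv 2 ℝ (Finset (Fin m) → ℝ)).symm).toLinearMap

theorem coords_injective (m : ℕ) : Function.Injective (coords m) :=
  ((basis m).equivFun.trans (WithLp.linearEquiv 2 ℝ (Finset (Fin m) → ℝ)).symm).injective

instance instNormedAddCommGroup (m : ℕ) : NormedAddCommGroup (Cl m) :=
  NormedAddCommGroup.induced (Cl m) (EuclideanSpace ℝ (Finset (Fin m))) (coords m)
    (coords_injective m)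

instance instNormedSpace (m : ℕ) : NormedSpace ℝ (Cl m) :=
  NormedSpace.induced ℝ (Cl m) (EuclideanSpace ℝ (Finset (Fin m))) (coords m)

/-- `|x| = (∑_A x_A²)^{1/2}` for `x = ∑_A x_A e_A`. -/
theorem norm_eq {m : ℕ} (x : Cl m) : ‖x‖ = √(∑ A, (basis m).repr x A ^ 2) := by
  change ‖coords m x‖ = _
  rw [EuclideanSpace.norm_eq]
  simp [coords]

instance instFinite (m : ℕ) : Module.Finite ℝ (Cl m) := Module.Finite.of_basis (basis m)

instance instComplete (m : ℕ) : CompleteSpace (Cl m) := FiniteDimensional.complete ℝ (Cl m)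

/-! ### Paravectors and slice functions -/

/-- The space `ℝ^{m+1} = ℝ ⊕ ℝ^m` of paravectors `x = x_0 + x̲`, stored as `(x_0, x̲)`. Its topology
and its measure `volume` are the usual topology and Lebesgue measure of `ℝ^{m+1}`; the Euclidean
length is `normSq` below, not the norm that the product type carries. -/
abbrev Para (m : ℕ) : Type := ℝ × Vec m

/-- The square `|x|² = x_0² + |x̲|²` of the Euclidean length of a paravector. -/
def normSq {m : ℕ} (x : Para m) : ℝ := x.1 ^ 2 + ‖x.2‖ ^ 2

/-- The paravector `x_0 + x̲` as a Clifford number. -/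
def para {m : ℕ} (x : Para m) : Cl m := algebraMap ℝ (Cl m) x.1 + vec x.2

/-- The sphere `𝕊` of the unit `1`-vectors. -/
abbrev unitSphere (m : ℕ) : Set (Vec m) := Metric.sphere 0 1

/-- `Φ_J (u + i v) = u + J v`. -/
def slicePoint {m : ℕ} (J : Vec m) (z : ℂ) : Para m := (z.re, z.im • J)

/-- The axially symmetric set `Ω_D = ⋃_{J ∈ 𝕊} Φ_J(D)`. -/
def Omega (m : ℕ) (D : Set ℂ) : Set (Para m) := ⋃ J ∈ unitSphere m, slicePoint J '' D

/-- `F_1 + i F_2`, with Clifford-valued `F_1` and `F_2`, is a stem function on `D`: its value at the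
conjugate of `z` is `F_1(z) - i F_2(z)`. -/
structure IsStem {m : ℕ} (D : Set ℂ) (F₁ F₂ : ℂ → Cl m) : Prop where
  even : ∀ z ∈ D, F₁ (starRingEnd ℂ z) = F₁ z
  odd : ∀ z ∈ D, F₂ (starRingEnd ℂ z) = -F₂ z

/-- On `Ω_D`, the function `f` is given by `f(u + J v) = F_1(u + i v) + J F_2(u + i v)`. -/
def Induces {m : ℕ} (D : Set ℂ) (F₁ F₂ : ℂ → Cl m) (f : Para m → Cl m) : Prop :=
  ∀ z ∈ D, ∀ J ∈ unitSphere m, f (slicePoint J z) = F₁ z + vec J * F₂ z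

/-- `f` is (on `Ω_D`) a left slice function; its values outside `Ω_D` do not matter. -/
def IsSlice {m : ℕ} (D : Set ℂ) (f : Para m → Cl m) : Prop :=
  ∃ F₁ F₂ : ℂ → Cl m, IsStem D F₁ F₂ ∧ Induces D F₁ F₂ f

/-- The space `𝓛^p(Ω_D) = 𝓢(Ω_D) ∩ L^p(Ω_D)`: the classes in `L^p(Ω_D)` of slice functions,
with the `L^p` norm. -/
def sliceLp (m : ℕ) (D : Set ℂ) (p : ℝ≥0∞) :
    Submodule ℝ (Lp (Cl m) p (volume.restrict (Omega m D))) where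
  carrier := {f | ∃ g : Para m → Cl m, IsSlice D g ∧ f =ᵐ[volume.restrict (Omega m D)] g}
  zero_mem' := ⟨0, ⟨0, 0, ⟨by simp, by simp⟩, by simp [Induces]⟩, Lp.coeFn_zero _ _ _⟩
  add_mem' := by
    rintro f f' ⟨g, ⟨F₁, F₂, h, hg⟩, hf⟩ ⟨g', ⟨F₁', F₂', h', hg'⟩, hf'⟩
    refine ⟨g + g', ⟨F₁ + F₁', F₂ + F₂', ⟨fun z hz => ?_, fun z hz => ?_⟩,
      fun z hz J hJ => ?_⟩, (Lp.coeFn_add f f').trans (hf.add hf')⟩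
    · simp [h.even z hz, h'.even z hz]
    · simp [h.odd z hz, h'.odd z hz, add_comm]
    · simp [hg z hz J hJ, hg' z hz J hJ, mul_add, add_add_add_comm]
  smul_mem' := by
    rintro c f ⟨g, ⟨F₁, F₂, h, hg⟩, hf⟩
    refine ⟨c • g, ⟨c • F₁, c • F₂, ⟨fun z hz => ?_, fun z hz => ?_⟩,
      fun z hz J hJ => ?_⟩, (Lp.coeFn_smul c f).trans (hf.const_smul c)⟩
    · simp [h.even z hz]
    · simp [h.odd z hz]
    · simp [hg z hz J hJ]

/-! ### The kernels and the Teodorescu transform -/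

/-- The area of the unit sphere of `ℝ^m` (two points of mass one if `m = 1`). -/
def sphereArea (m : ℕ) : ℝ := (volume : Measure (Vec m)).toSphere.real univ

/-- The slice Cauchy kernel `S⁻¹(q, x) = -(q² - 2 Re[x] q + |x|²)⁻¹ (q - x̄)`, where `x̄` is the
Clifford conjugate. The first factor is the inverse in the Clifford algebra, read as `0` where
`q² - 2 Re[x] q + |x|²` is not invertible. -/
def cauchyKernel {m : ℕ} (q x : Para m) : Cl m :=
  -(Ring.inverse (para q ^ 2 - (2 * x.1) • para q + algebraMap ℝ (Cl m) (normSq x)) *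
    (para q - star (para x)))

/-- `K(q, x) = 2 S⁻¹(q, x) / (ω_{m-1} |x̲|^{m-1})`. -/
def kernel {m : ℕ} (q x : Para m) : Cl m :=
  (2 / (sphereArea m * ‖x.2‖ ^ (m - 1))) • cauchyKernel q x

/-- The Teodorescu transform `T_{Ω_D} f (q) = -(2π)⁻¹ ∫_{Ω_D} K(q, x) f(x) dV(x)`. -/
def teodorescu {m : ℕ} (D : Set ℂ) (f : Para m → Cl m) (q : Para m) : Cl m :=
  -(1 / (2 * Real.pi)) • ∫ x in Omega m D, kernel q x * f x

/-- The complex number `z² - 2 Re[x] z + |x|²`. -/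
def charPoly {m : ℕ} (z : ℂ) (x : Para m) : ℂ := z ^ 2 - 2 * (x.1 : ℂ) * z + (normSq x : ℂ)

/-- The first component of `-(z² - 2 Re[x] z + |x|²)⁻¹ (z - x̄)`, an element of `ℂ ⊗ Cl_m`. -/
def kernelStem₁ {m : ℕ} (z : ℂ) (x : Para m) : Cl m :=
  -(algebraMap ℝ (Cl m) ((charPoly z x)⁻¹ * z).re - ((charPoly z x)⁻¹).re • star (para x))

/-- The second component of `-(z² - 2 Re[x] z + |x|²)⁻¹ (z - x̄)`. -/
def kernelStem₂ {m : ℕ} (z : ℂ) (x : Para m) : Cl m :=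
  -(algebraMap ℝ (Cl m) ((charPoly z x)⁻¹ * z).im - ((charPoly z x)⁻¹).im • star (para x))

/-- `H(z) = -(π ω_{m-1})⁻¹ ∫_{Ω_D} |x̲|^{1-m} F(z, x) f(x) dV(x)` for a component `F` of the stem
function of the slice Cauchy kernel. -/
def stemTransform {m : ℕ} (F : ℂ → Para m → Cl m) (D : Set ℂ) (f : Para m → Cl m) (z : ℂ) :
    Cl m :=
  -(1 / (Real.pi * sphereArea m)) •
    ∫ x in Omega m D, (‖x.2‖ ^ (m - 1))⁻¹ • (F z x * f x)

end SliceClifford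

end

/-!
On the slice `ℝ + J ℝ ≅ ℂ` the Cauchy kernel is a `ℂ ⊗ Cl_m`-valued function of `z` whose
components do not depend on `J`; integrating them against `f` gives a stem function that induces
`T f`.

For the estimates put `h(x) = x₀ + i |x̲|` and move `z` into the upper half plane by conjugation.
Then `z² - 2 Re[x] z + |x|² = (z - h(x)) (z - conj h(x))`, and each component of the kernel is
bounded by `2 / |z - h(x)|`. Let `s` be the exponent conjugate to `p`. Since `p > max {m, 2}`, there
is a `β < 1` with `(m - 1) (s - 1) < β` and `s - 1 < β`; splitting
`|z - h(x)|^(-s) ≤ |Re z - x₀|^(-(s - β)) |Im z - |x̲||^(-β)` and integrating in polar coordinates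
in `x̲`, one finds that the `L^s` norm of the weighted kernel is at most `C |Im z|^(-(m - 1) / p)`.
Hence `|T f(q)| ≤ C |q̲|^(-(m - 1) / p) ‖f‖_p` by Hölder's inequality, and the `p`-th power of this
weight is integrable on bounded sets because `m - 1 < m`.
-/

noncomputable section

namespace SliceClifford

variable {m : ℕ}

/-! ### Clifford numbers as a normed space -/

/-- Multiplication of Clifford numbers as a bounded bilinear map. The Euclidean norm of `Cl m` is
not submultiplicative, so estimates of products carry the factor `‖mulCLM m‖`. -/
def mulCLM (m : ℕ) : Cl m →L[ℝ] Cl m →L[ℝ] Cl m :=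
  (LinearMap.mul ℝ (Cl m)).toContinuousBilinearMap

theorem mulCLM_apply (a b : Cl m) : mulCLM m a b = a * b := rfl

theorem enorm_mul_le (a b : Cl m) : ‖a * b‖ₑ ≤ ‖mulCLM m‖ₑ * ‖a‖ₑ * ‖b‖ₑ :=
  (mulCLM m).le_opENorm₂ a b

instance instContinuousMul : ContinuousMul (Cl m) := ⟨(mulCLM m).continuous₂⟩

theorem coords_basis (A : Finset (Fin m)) : coords m (basis m A) = EuclideanSpace.single A 1 := by
  ext B
  simp [coords, Finsupp.single_apply, eq_comm]

theorem norm_basis (A : Finset (Fin m)) : ‖basis m A‖ = 1 := by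
  change ‖coords m (basis m A)‖ = 1
  rw [coords_basis, PiLp.norm_single, norm_one]

instance instNormOneClass : NormOneClass (Cl m) :=
  ⟨by simpa [basis_apply] using norm_basis (∅ : Finset (Fin m))⟩

theorem norm_vec (v : Vec m) : ‖(vec v : Cl m)‖ = ‖v‖ := by
  let e := EuclideanSpace.basisFun (Fin m) ℝ
  have he : (coords m ∘ₗ vec) ∘ e.toBasis =
      EuclideanSpace.basisFun (Finset (Fin m)) ℝ ∘ singleton := by
    funext i
    simpa [basis_apply, gen, e] using coords_basis {i}
  have h : Orthonormal ℝ ((coords m ∘ₗ vec) ∘ e.toBasis) :=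
    he ▸ (EuclideanSpace.basisFun _ ℝ).orthonormal.comp _ Finset.singleton_injective
  exact (LinearMap.isometryOfOrthonormal _ (e.coe_toBasis ▸ e.orthonormal) h).norm_map v

theorem continuous_vec : Continuous (vec : Vec m → Cl m) :=
  LinearMap.continuous_of_finiteDimensional _

/-! ### The stem function of the Cauchy kernel -/

theorem vec_mul_self {J : Vec m} (hJ : J ∈ unitSphere m) : (vec J * vec J : Cl m) = -1 := by
  rw [CliffordAlgebra.ι_sq_scalar, negForm_apply, mem_sphere_zero_iff_norm.1 hJ]
  simp

theorem star_para (x : Para m) : star (para x) = algebraMap ℝ (Cl m) x.1 - vec x.2 := by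
  rw [para, star_add, CliffordAlgebra.star_algebraMap, CliffordAlgebra.star_ι, sub_eq_add_neg]

theorem ringInverse_map {F K M : Type*} [GroupWithZero K] [MonoidWithZero M] [FunLike F K M]
    [MonoidWithZeroHomClass F K M] (φ : F) (c : K) : Ring.inverse (φ c) = φ c⁻¹ := by
  rcases eq_or_ne c 0 with rfl | hc
  · simp
  · exact Ring.inverse_unit (Units.map (φ : K →* M) (Units.mk0 c hc))

theorem cauchyKernel_slicePoint {J : Vec m} (hJ : J ∈ unitSphere m) (z : ℂ) (x : Para m) :
    cauchyKernel (slicePoint J z) x = kernelStem₁ z x + vec J * kernelStem₂ z x := by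
  -- `φ` embeds `ℂ` as the slice `ℝ + J ℝ`, so inversion in `Cl m` becomes inversion in `ℂ`.
  let φ : ℂ →ₐ[ℝ] Cl m := Complex.liftAux (vec J) (vec_mul_self hJ)
  have φ_apply (c : ℂ) : φ c = algebraMap ℝ (Cl m) c.re + vec J * algebraMap ℝ (Cl m) c.im := by
    rw [Complex.liftAux_apply, ← Algebra.commutes, Algebra.smul_def]
  have φ_ofReal (r : ℝ) : φ (r : ℂ) = algebraMap ℝ (Cl m) r := φ.commutes r
  have para_eq : para (slicePoint J z) = φ z := by
    rw [Complex.liftAux_apply, para, slicePoint, map_smul]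
  have charPoly_eq : para (slicePoint J z) ^ 2 - (2 * x.1) • para (slicePoint J z) +
      algebraMap ℝ (Cl m) (normSq x) = φ (charPoly z x) := by
    simp only [para_eq, charPoly, map_add, map_sub, map_mul, map_pow, map_ofNat, φ_ofReal,
      Algebra.smul_def]
  have inverse_eq : Ring.inverse (φ (charPoly z x)) = φ (charPoly z x)⁻¹ :=
    ringInverse_map φ _
  rw [cauchyKernel, charPoly_eq, inverse_eq, para_eq, mul_sub, ← map_mul, φ_apply, φ_apply,
    kernelStem₁, kernelStem₂, Algebra.smul_def, Algebra.smul_def]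
  noncomm_ring

theorem charPoly_conj (z : ℂ) (x : Para m) :
    charPoly (starRingEnd ℂ z) x = starRingEnd ℂ (charPoly z x) := by
  simp [charPoly, map_ofNat]

theorem kernelStem₁_conj (z : ℂ) (x : Para m) :
    kernelStem₁ (starRingEnd ℂ z) x = kernelStem₁ z x := by
  rw [kernelStem₁, charPoly_conj, ← map_inv₀, ← map_mul, Complex.conj_re, Complex.conj_re,
    kernelStem₁]

theorem kernelStem₂_conj (z : ℂ) (x : Para m) :
    kernelStem₂ (starRingEnd ℂ z) x = -kernelStem₂ z x := by
  rw [kernelStem₂, charPoly_conj, ← map_inv₀, ← map_mul, Complex.conj_im, Complex.conj_im,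
    kernelStem₂, map_neg, neg_smul]
  abel

theorem isStem_kernelStem (D : Set ℂ) (x : Para m) :
    IsStem D (fun z => kernelStem₁ z x) (fun z => kernelStem₂ z x) :=
  ⟨fun z _ => kernelStem₁_conj z x, fun z _ => kernelStem₂_conj z x⟩

theorem induces_cauchyKernel (D : Set ℂ) (x : Para m) :
    Induces D (fun z => kernelStem₁ z x) (fun z => kernelStem₂ z x)
      (fun q => cauchyKernel q x) :=
  fun z _ _ hJ => cauchyKernel_slicePoint hJ z x

/-! ### Half-plane coordinates -/

/-- The point `x₀ + i |x̲|` of the closed upper half plane. It determines the orbit of `x` under the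
rotations of `ℝ^m`. -/
def halfPlane (x : Para m) : ℂ := ⟨x.1, ‖x.2‖⟩

/-- The representative of `{z, z̄}` in the closed upper half plane. -/
def foldUpper (z : ℂ) : ℂ := ⟨z.re, |z.im|⟩

theorem foldUpper_eq_or (z : ℂ) : foldUpper z = z ∨ foldUpper z = starRingEnd ℂ z := by
  rcases le_total 0 z.im with h | h
  · exact .inl (Complex.ext rfl (abs_of_nonneg h))
  · exact .inr (Complex.ext rfl (by simp [foldUpper, abs_of_nonpos h]))

theorem halfPlane_slicePoint {J : Vec m} (hJ : J ∈ unitSphere m) (z : ℂ) :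
    halfPlane (slicePoint J z) = foldUpper z := by
  simp [halfPlane, slicePoint, foldUpper, norm_smul, mem_sphere_zero_iff_norm.1 hJ]

theorem inv_norm_smul_mem_unitSphere {v : Vec m} (hv : v ≠ 0) : ‖v‖⁻¹ • v ∈ unitSphere m := by
  simp [norm_smul, norm_ne_zero_iff.2 hv]

theorem slicePoint_halfPlane {x : Para m} (hx : x.2 ≠ 0) :
    slicePoint (‖x.2‖⁻¹ • x.2) (halfPlane x) = x :=
  Prod.ext rfl (by simp [slicePoint, halfPlane, smul_smul, norm_ne_zero_iff.2 hx])

theorem continuous_halfPlane : Continuous (halfPlane : Para m → ℂ) :=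
  Complex.equivRealProdCLM.symm.continuous.comp (by fun_prop : Continuous fun x : Para m =>
    (x.1, ‖x.2‖))

theorem charPoly_eq_mul (z : ℂ) (x : Para m) :
    charPoly z x = (z - halfPlane x) * (z - starRingEnd ℂ (halfPlane x)) := by
  apply Complex.ext <;> simp [charPoly, halfPlane, normSq, pow_two] <;> ring

theorem norm_charPoly (z : ℂ) (x : Para m) :
    ‖charPoly z x‖ =
      ‖foldUpper z - halfPlane x‖ * ‖foldUpper z - starRingEnd ℂ (halfPlane x)‖ := by
  rw [← norm_mul, ← charPoly_eq_mul]
  rcases foldUpper_eq_or z with h | h <;> rw [h]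
  rw [charPoly_conj, RCLike.norm_conj]

theorem norm_sub_fst_le (z : ℂ) (x : Para m) :
    ‖z - x.1‖ ≤ ‖foldUpper z - starRingEnd ℂ (halfPlane x)‖ := by
  rw [← sq_le_sq₀ (norm_nonneg _) (norm_nonneg _), Complex.sq_norm, Complex.sq_norm,
    Complex.normSq_apply, Complex.normSq_apply]
  simp only [foldUpper, halfPlane, Complex.sub_re, Complex.sub_im, Complex.ofReal_re,
    Complex.ofReal_im, Complex.conj_re, Complex.conj_im]
  nlinarith [norm_nonneg x.2, abs_mul_abs_self z.im, mul_nonneg (abs_nonneg z.im) (norm_nonneg x.2)]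

theorem norm_snd_le_norm_sub (z : ℂ) (x : Para m) :
    ‖x.2‖ ≤ ‖foldUpper z - starRingEnd ℂ (halfPlane x)‖ := by
  refine le_trans ?_ (Complex.im_le_norm _)
  simp [foldUpper, halfPlane]

theorem norm_inv_charPoly_mul_le (z : ℂ) (x : Para m) :
    ‖(charPoly z x)⁻¹‖ * (‖z - x.1‖ + ‖x.2‖) ≤ 2 * ‖foldUpper z - halfPlane x‖⁻¹ := by
  rw [norm_inv, norm_charPoly]
  set d := ‖foldUpper z - halfPlane x‖
  set ρ := ‖foldUpper z - starRingEnd ℂ (halfPlane x)‖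
  have hρ : ρ⁻¹ * ρ ≤ 1 := inv_mul_le_one
  calc (d * ρ)⁻¹ * (‖z - x.1‖ + ‖x.2‖) ≤ (d * ρ)⁻¹ * (ρ + ρ) := by
        gcongr
        · exact norm_sub_fst_le z x
        · exact norm_snd_le_norm_sub z x
    _ = 2 * d⁻¹ * (ρ⁻¹ * ρ) := by rw [mul_inv]; ring
    _ ≤ 2 * d⁻¹ := mul_le_of_le_one_right (by positivity) hρ

/-! ### Kernels of Cauchy type -/

/-- A jointly measurable Clifford-valued kernel that is dominated, in half-plane coordinates, by
twice the planar Cauchy kernel. Both components of the stem function of the slice Cauchy kernel are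
of this type, and the estimates of the transform only use this property. -/
structure IsCauchyType (F : ℂ → Para m → Cl m) : Prop where
  stronglyMeasurable : StronglyMeasurable fun y : ℂ × Para m => F y.1 y.2
  norm_le : ∀ z x, ‖F z x‖ ≤ 2 * ‖foldUpper z - halfPlane x‖⁻¹

theorem IsCauchyType.enorm_le {F : ℂ → Para m → Cl m} (hF : IsCauchyType F) (z : ℂ) (x : Para m) :
    ‖F z x‖ₑ ≤ 2 * ‖foldUpper z - halfPlane x‖ₑ⁻¹ := by
  rcases eq_or_ne (foldUpper z - halfPlane x) 0 with h | h
  · simp [h]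
  · rw [← enorm_inv h]
    simpa [enorm_mul, ← ofReal_norm, ENNReal.ofReal_mul] using
      ENNReal.ofReal_le_ofReal (hF.norm_le z x)

theorem IsCauchyType.of_clm (φ : ℂ →L[ℝ] ℝ) (hφ : ‖φ‖ ≤ 1) {F : ℂ → Para m → Cl m}
    (hF : ∀ z x, F z x = -(φ ((charPoly z x)⁻¹ * (z - x.1)) • (1 : Cl m) +
      φ (charPoly z x)⁻¹ • vec x.2)) : IsCauchyType F where
  stronglyMeasurable := by
    have hc : Measurable fun y : ℂ × Para m => (charPoly y.1 y.2)⁻¹ :=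
      (by unfold charPoly normSq; fun_prop : Measurable fun y : ℂ × Para m =>
        charPoly y.1 y.2).inv
    have h₁ : Measurable fun y : ℂ × Para m => φ ((charPoly y.1 y.2)⁻¹ * (y.1 - y.2.1)) := by
      fun_prop
    have h₂ : Measurable fun y : ℂ × Para m => φ (charPoly y.1 y.2)⁻¹ := by fun_prop
    have hv : Continuous fun y : ℂ × Para m => (vec y.2.2 : Cl m) :=
      continuous_vec.comp (by fun_prop)
    simp_rw [hF]
    exact ((h₁.stronglyMeasurable.smul_const _).add
      (h₂.stronglyMeasurable.smul hv.stronglyMeasurable)).neg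
  norm_le z x := by
    have hφ_le (c : ℂ) : ‖φ c‖ ≤ ‖c‖ := φ.le_of_opNorm_le_of_le hφ le_rfl |>.trans_eq (one_mul _)
    calc ‖F z x‖ ≤ ‖φ ((charPoly z x)⁻¹ * (z - x.1))‖ + ‖φ (charPoly z x)⁻¹‖ * ‖x.2‖ := by
          rw [hF, norm_neg]
          refine (norm_add_le _ _).trans_eq ?_
          rw [norm_smul, norm_smul, norm_one, norm_vec, mul_one]
      _ ≤ ‖(charPoly z x)⁻¹‖ * (‖z - x.1‖ + ‖x.2‖) := by
          rw [mul_add, ← norm_mul]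
          gcongr <;> exact hφ_le _
      _ ≤ _ := norm_inv_charPoly_mul_le z x

theorem kernelStem₁_eq (z : ℂ) (x : Para m) :
    kernelStem₁ z x = -(((charPoly z x)⁻¹ * (z - x.1)).re • (1 : Cl m) +
      ((charPoly z x)⁻¹).re • vec x.2) := by
  rw [kernelStem₁, star_para, smul_sub, Algebra.algebraMap_eq_smul_one,
    Algebra.algebraMap_eq_smul_one, smul_smul, mul_sub, Complex.sub_re, Complex.re_mul_ofReal,
    sub_smul]
  abel

theorem kernelStem₂_eq (z : ℂ) (x : Para m) :
    kernelStem₂ z x = -(((charPoly z x)⁻¹ * (z - x.1)).im • (1 : Cl m) +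
      ((charPoly z x)⁻¹).im • vec x.2) := by
  rw [kernelStem₂, star_para, smul_sub, Algebra.algebraMap_eq_smul_one,
    Algebra.algebraMap_eq_smul_one, smul_smul, mul_sub, Complex.sub_im, Complex.im_mul_ofReal,
    sub_smul]
  abel

theorem isCauchyType_kernelStem₁ : IsCauchyType (kernelStem₁ (m := m)) :=
  .of_clm Complex.reCLM Complex.reCLM_norm.le kernelStem₁_eq

theorem isCauchyType_kernelStem₂ : IsCauchyType (kernelStem₂ (m := m)) :=
  .of_clm Complex.imCLM Complex.imCLM_norm.le kernelStem₂_eq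

/-! ### Integrals of negative powers -/

section Integrals

variable {E : Type*} [NormedAddCommGroup E] [MeasurableSpace E] [BorelSpace E]

theorem enorm_rpow_neg_le {F G : Type*} [SeminormedAddCommGroup F] [SeminormedAddCommGroup G]
    {x : F} {y : G} {a : ℝ} (ha : 0 ≤ a) (h : ‖x‖ ≤ ‖y‖) : ‖y‖ₑ ^ (-a) ≤ ‖x‖ₑ ^ (-a) := by
  rw [ENNReal.rpow_neg, ENNReal.rpow_neg, ENNReal.inv_le_inv]
  exact ENNReal.rpow_le_rpow (enorm_le_iff_norm_le.2 h) ha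

theorem lintegral_ball_sub_left_le (μ : Measure E) [μ.IsAddLeftInvariant] [μ.IsNegInvariant]
    (f : E → ℝ≥0∞) {v : E} {r : ℝ} (hv : ‖v‖ ≤ r) (R : ℝ) :
    ∫⁻ x in Metric.ball 0 R, f (v - x) ∂μ ≤ ∫⁻ x in Metric.ball 0 (r + R), f x ∂μ := by
  rw [← (μ.measurePreserving_sub_left v).setLIntegral_comp_preimage_emb
    (Homeomorph.subLeft v).measurableEmbedding f]
  refine lintegral_mono_set fun x hx => ?_
  rw [mem_preimage, mem_ball_zero_iff]
  exact (norm_sub_le v x).trans_lt (add_lt_add_of_le_of_lt hv (mem_ball_zero_iff.1 hx))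

variable [NormedSpace ℝ E] [FiniteDimensional ℝ E] [Nontrivial E] (μ : Measure E)
  [μ.IsAddHaarMeasure]

theorem lintegral_fun_norm {f : ℝ → ℝ≥0∞} (hf : Measurable f) :
    ∫⁻ x, f ‖x‖ ∂μ = μ.toSphere univ *
      ∫⁻ y in Ioi (0 : ℝ), ENNReal.ofReal (y ^ (Module.finrank ℝ E - 1)) * f y :=
  calc
    ∫⁻ x, f ‖x‖ ∂μ = ∫⁻ x : ({(0)}ᶜ : Set E), f ‖x.1‖ ∂(μ.comap (↑)) := by
      rw [lintegral_subtype_comap (measurableSet_singleton _).compl fun x ↦ f ‖x‖,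
        restrict_compl_singleton]
    _ = ∫⁻ x, f x.2 ∂μ.toSphere.prod (.volumeIoiPow (Module.finrank ℝ E - 1)) := by
      simpa using μ.measurePreserving_homeomorphUnitSphereProd.lintegral_comp_emb
        (Homeomorph.measurableEmbedding _) (f ∘ Subtype.val ∘ Prod.snd)
    _ = μ.toSphere univ *
        ∫⁻ x : Ioi (0 : ℝ), f x ∂.volumeIoiPow (Module.finrank ℝ E - 1) := by
      simpa using lintegral_prod_mul (μ := μ.toSphere)
        (ν := .volumeIoiPow (Module.finrank ℝ E - 1)) (f := fun _ => 1) (g := fun x => f x)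
        aemeasurable_const (hf.comp measurable_subtype_coe).aemeasurable
    _ = _ := by
      rw [← lintegral_subtype_comap measurableSet_Ioi]
      exact congrArg _ (lintegral_withDensity_eq_lintegral_mul _
        (measurable_subtype_coe.pow_const _).ennreal_ofReal (hf.comp measurable_subtype_coe))

theorem lintegral_ball_enorm_rpow_lt_top {α : ℝ} (hα : α < Module.finrank ℝ E) (R : ℝ) :
    ∫⁻ x in Metric.ball (0 : E) R, ‖x‖ₑ ^ (-α) ∂μ < ⊤ := by
  have h : IntegrableOn (fun x : E => ‖x‖ ^ (-α)) (Metric.ball 0 R) μ :=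
    integrableOn_ball_of_norm_le_rpow Module.finrank_pos hα (C := 1)
      (.of_forall fun x => by simp [abs_of_nonneg, Real.rpow_nonneg])
      (by fun_prop : Measurable fun x : E => ‖x‖ ^ (-α)).aestronglyMeasurable
  refine lt_of_le_of_lt (le_of_eq (lintegral_congr_ae ?_)) h.2
  filter_upwards [ae_restrict_of_ae (Measure.ae_ne μ 0)] with x hx
  rw [Real.enorm_of_nonneg (by positivity), ← ENNReal.ofReal_rpow_of_pos (norm_pos_iff.2 hx),
    ofReal_norm]

theorem lintegral_ball_radial (R a : ℝ) {g : ℝ → ℝ≥0∞} (hg : Measurable g) :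
    ∫⁻ x in Metric.ball 0 R, ‖x‖ₑ ^ (-((Module.finrank ℝ E - 1 : ℕ) + a)) * g ‖x‖ ∂μ =
      μ.toSphere univ * ∫⁻ y in Ioo 0 R, ‖y‖ₑ ^ (-a) * g y := by
  set n := Module.finrank ℝ E - 1
  let f (y : ℝ) : ℝ≥0∞ := ‖y‖ₑ ^ (-((n : ℝ) + a)) * g y
  have hball : Metric.ball (0 : E) R = norm ⁻¹' Iio R := by ext; simp
  calc ∫⁻ x in Metric.ball 0 R, ‖x‖ₑ ^ (-((n : ℝ) + a)) * g ‖x‖ ∂μ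
      = ∫⁻ x : E, (Iio R).indicator f ‖x‖ ∂μ := by
        rw [← lintegral_indicator Metric.isOpen_ball.measurableSet, hball]
        simp [indicator, f]
    _ = μ.toSphere univ * ∫⁻ y in Ioi (0 : ℝ), ENNReal.ofReal (y ^ n) * (Iio R).indicator f y :=
        lintegral_fun_norm μ (Measurable.indicator (by fun_prop) measurableSet_Iio)
    _ = μ.toSphere univ * ∫⁻ y in Ioo 0 R, ENNReal.ofReal (y ^ n) * f y := by
        have h (y : ℝ) : ENNReal.ofReal (y ^ n) * (Iio R).indicator f y =
            (Iio R).indicator (fun y => ENNReal.ofReal (y ^ n) * f y) y :=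
          (indicator_mul_right _ (fun y => ENNReal.ofReal (y ^ n)) f).symm
        simp_rw [h]
        rw [setLIntegral_indicator measurableSet_Iio, inter_comm, Ioi_inter_Iio]
    _ = _ := by
        refine congrArg _ (setLIntegral_congr_fun measurableSet_Ioo fun y hy => ?_)
        have hpow : ENNReal.ofReal (y ^ n) = ‖y‖ₑ ^ (n : ℝ) := by
          rw [ENNReal.rpow_natCast, ← enorm_pow, Real.enorm_of_nonneg (pow_nonneg hy.1.le n)]
        rw [hpow, ← mul_assoc, ← ENNReal.rpow_add _ _ (by simpa using hy.1.ne') (by simp)]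
        congr 2
        ring

theorem enorm_rpow_mul_enorm_sub_rpow_le {a β v y : ℝ} (ha : 0 ≤ a) (hβ : a ≤ β) (hv : 0 < v)
    (hy : 0 < y) :
    ‖y‖ₑ ^ (-a) * ‖v - y‖ₑ ^ (-β) ≤ ‖v / 2‖ₑ ^ (-a) * (‖v - y‖ₑ ^ (-β) + ‖y‖ₑ ^ (-β)) := by
  have le_norm {r t : ℝ} (hr : 0 < r) (h : r ≤ t) : ‖r‖ ≤ ‖t‖ := by
    rwa [Real.norm_of_nonneg hr.le, Real.norm_of_nonneg (hr.le.trans h)]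
  rcases le_total (v / 2) y with h | h
  · exact mul_le_mul' (enorm_rpow_neg_le ha (le_norm (by positivity) h)) le_self_add
  have h_half : v / 2 ≤ v - y := by linarith
  have split (t : ℝ) (ht : 0 < t) : ‖t‖ₑ ^ (-β) = ‖t‖ₑ ^ (-a) * ‖t‖ₑ ^ (-(β - a)) := by
    rw [← ENNReal.rpow_add _ _ (by simpa using ht.ne') (by simp)]
    congr 1
    ring
  calc ‖y‖ₑ ^ (-a) * ‖v - y‖ₑ ^ (-β)
      = ‖y‖ₑ ^ (-a) * (‖v - y‖ₑ ^ (-a) * ‖v - y‖ₑ ^ (-(β - a))) := by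
        rw [← split _ (by linarith)]
    _ ≤ ‖y‖ₑ ^ (-a) * (‖v / 2‖ₑ ^ (-a) * ‖y‖ₑ ^ (-(β - a))) := by
        gcongr ?_ * (?_ * ?_)
        · exact le_rfl
        · exact enorm_rpow_neg_le ha (le_norm (by positivity) h_half)
        · exact enorm_rpow_neg_le (by linarith) (le_norm hy (h.trans h_half))
    _ = ‖v / 2‖ₑ ^ (-a) * ‖y‖ₑ ^ (-β) := by rw [split y hy]; ring
    _ ≤ _ := by gcongr; exact le_add_self

theorem exists_lintegral_ball_radial_le (R : ℝ) {a β : ℝ} (ha : 0 ≤ a) (hβ : a ≤ β)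
    (hβ1 : β < 1) :
    ∃ C : ℝ≥0∞, C ≠ ⊤ ∧ ∀ v, 0 < v → v < R →
      ∫⁻ x in Metric.ball 0 R,
        ‖x‖ₑ ^ (-((Module.finrank ℝ E - 1 : ℕ) + a)) * ‖v - ‖x‖‖ₑ ^ (-β) ∂μ ≤
      C * ‖v‖ₑ ^ (-a) := by
  let I (r : ℝ) : ℝ≥0∞ := ∫⁻ y in Metric.ball (0 : ℝ) r, ‖y‖ₑ ^ (-β)
  have hI (r : ℝ) : I r ≠ ⊤ := (lintegral_ball_enorm_rpow_lt_top volume (by simpa) r).ne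
  refine ⟨μ.toSphere univ * (‖(2⁻¹ : ℝ)‖ₑ ^ (-a) * (I (R + R) + I R)), ?_, fun v hv hvR => ?_⟩
  · exact ENNReal.mul_ne_top (measure_ne_top _ _) (ENNReal.mul_ne_top
      (ENNReal.rpow_ne_top_of_ne_zero (by simp) (by simp)) (ENNReal.add_ne_top.2 ⟨hI _, hI _⟩))
  have hsub : Ioo 0 R ⊆ Metric.ball (0 : ℝ) R := fun y hy => by
    rw [mem_ball_zero_iff, Real.norm_of_nonneg hy.1.le]
    exact hy.2
  have hhalf : ‖v / 2‖ₑ ^ (-a) = ‖v‖ₑ ^ (-a) * ‖(2⁻¹ : ℝ)‖ₑ ^ (-a) := by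
    rw [div_eq_mul_inv, enorm_mul, ENNReal.mul_rpow_of_ne_top (by simp) (by simp)]
  have hle : ∫⁻ y in Ioo 0 R, ‖y‖ₑ ^ (-a) * ‖v - y‖ₑ ^ (-β) ≤
      ‖v / 2‖ₑ ^ (-a) * (I (R + R) + I R) :=
    calc ∫⁻ y in Ioo 0 R, ‖y‖ₑ ^ (-a) * ‖v - y‖ₑ ^ (-β)
        ≤ ∫⁻ y in Ioo 0 R, ‖v / 2‖ₑ ^ (-a) * (‖v - y‖ₑ ^ (-β) + ‖y‖ₑ ^ (-β)) :=
          setLIntegral_mono' measurableSet_Ioo fun y hy =>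
            enorm_rpow_mul_enorm_sub_rpow_le ha hβ hv hy.1
      _ ≤ ∫⁻ y in Metric.ball 0 R, ‖v / 2‖ₑ ^ (-a) * (‖v - y‖ₑ ^ (-β) + ‖y‖ₑ ^ (-β)) :=
          lintegral_mono_set hsub
      _ = ‖v / 2‖ₑ ^ (-a) * ((∫⁻ y in Metric.ball 0 R, ‖v - y‖ₑ ^ (-β)) + I R) := by
          rw [lintegral_const_mul _ (by fun_prop), lintegral_add_left (by fun_prop)]
      _ ≤ _ := by
          gcongr
          exact lintegral_ball_sub_left_le volume (fun t => ‖t‖ₑ ^ (-β))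
            (by rw [Real.norm_of_nonneg hv.le]; exact hvR.le) R
  rw [lintegral_ball_radial μ R a (g := fun y => ‖v - y‖ₑ ^ (-β)) (by fun_prop)]
  calc _ ≤ μ.toSphere univ * (‖v / 2‖ₑ ^ (-a) * (I (R + R) + I R)) := by gcongr
    _ = _ := by rw [hhalf]; ring

theorem enorm_rpow_neg_add_le (ζ : ℂ) {a b : ℝ} (ha : 0 ≤ a) (hb : 0 ≤ b) :
    ‖ζ‖ₑ ^ (-(a + b)) ≤ ‖ζ.re‖ₑ ^ (-a) * ‖ζ.im‖ₑ ^ (-b) :=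
  calc ‖ζ‖ₑ ^ (-(a + b)) = ‖ζ‖ₑ ^ (-a) * ‖ζ‖ₑ ^ (-b) := by
        rw [ENNReal.rpow_neg, ENNReal.rpow_add_of_nonneg _ _ ha hb, ENNReal.mul_inv
          (.inr (ENNReal.rpow_ne_top_of_nonneg hb enorm_ne_top))
          (.inl (ENNReal.rpow_ne_top_of_nonneg ha enorm_ne_top)),
          ENNReal.rpow_neg, ENNReal.rpow_neg]
    _ ≤ _ := mul_le_mul' (enorm_rpow_neg_le ha (Complex.abs_re_le_norm ζ))
        (enorm_rpow_neg_le hb (Complex.abs_im_le_norm ζ))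

end Integrals

/-! ### The weighted kernel -/

theorem lintegral_ball_prod_mul {E F : Type*} [SeminormedAddCommGroup E] [MeasurableSpace E]
    [SeminormedAddCommGroup F] [MeasurableSpace F] (μ : Measure E) (ν : Measure F) [SFinite μ]
    [SFinite ν] (R : ℝ) {f : E → ℝ≥0∞} {g : F → ℝ≥0∞} (hf : Measurable f) (hg : Measurable g) :
    ∫⁻ x in Metric.ball 0 R, f x.1 * g x.2 ∂μ.prod ν =
      (∫⁻ x in Metric.ball 0 R, f x ∂μ) * ∫⁻ y in Metric.ball 0 R, g y ∂ν := by
  rw [← Prod.mk_zero_zero, ← ball_prod_same, ← Measure.prod_restrict,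
    lintegral_prod_mul hf.aemeasurable hg.aemeasurable]

theorem weighted_rpow_le (n : ℕ) (ζ : ℂ) (x : Para m) {s β : ℝ} (hβ : 0 ≤ β) (hβs : β ≤ s) :
    (‖x.2‖ₑ ^ (-(n : ℝ)) * ‖ζ - halfPlane x‖ₑ⁻¹) ^ s ≤
      ‖ζ.re - x.1‖ₑ ^ (-(s - β)) *
        (‖x.2‖ₑ ^ (-(n + n * (s - 1))) * ‖ζ.im - ‖x.2‖‖ₑ ^ (-β)) := by
  have hn : -(n : ℝ) * s = -(n + n * (s - 1)) := by ring
  have hs : -(s - β + β) = -1 * s := by ring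
  have h := enorm_rpow_neg_add_le (ζ - halfPlane x) (sub_nonneg.2 hβs) hβ
  rw [hs, ENNReal.rpow_mul, ENNReal.rpow_neg_one] at h
  rw [ENNReal.mul_rpow_of_nonneg _ _ (hβ.trans hβs), ← ENNReal.rpow_mul, hn]
  calc _ ≤ _ := mul_le_mul_right h _
    _ = _ := mul_left_comm _ _ _

theorem exists_lintegral_ball_weighted_le (hm : 1 ≤ m) {s : ℝ} (hs : 1 ≤ s) (hs2 : s < 2)
    (hms : (m - 1 : ℕ) * (s - 1) < 1) (R : ℝ) :
    ∃ C : ℝ≥0∞, C ≠ ⊤ ∧ ∀ ζ : ℂ, |ζ.re| < R → 0 < ζ.im → ζ.im < R →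
      ∫⁻ x in Metric.ball (0 : Para m) R,
        (‖x.2‖ₑ ^ (-((m - 1 : ℕ) : ℝ)) * ‖ζ - halfPlane x‖ₑ⁻¹) ^ s ≤
      C * ‖ζ.im‖ₑ ^ (-((m - 1 : ℕ) * (s - 1))) := by
  have : Nontrivial (Vec m) := Module.nontrivial_of_finrank_pos (R := ℝ)
    (by rwa [finrank_euclideanSpace_fin])
  set n := m - 1
  have hc : 0 ≤ n * (s - 1) := by have := sub_nonneg.2 hs; positivity
  obtain ⟨β, hβ, hβ1⟩ := exists_between (max_lt hms (by linarith : s - 1 < 1))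
  obtain ⟨hcβ, hsβ⟩ := max_lt_iff.1 hβ
  obtain ⟨C, hC, h_radial⟩ :=
    exists_lintegral_ball_radial_le (volume : Measure (Vec m)) R hc hcβ.le hβ1
  rw [finrank_euclideanSpace_fin] at h_radial
  let I : ℝ≥0∞ := ∫⁻ t in Metric.ball (0 : ℝ) (R + R), ‖t‖ₑ ^ (-(s - β))
  have hI : I < ⊤ := lintegral_ball_enorm_rpow_lt_top volume (by simp; linarith) _
  refine ⟨I * C, ENNReal.mul_ne_top hI.ne hC, fun ζ hre him himR => ?_⟩
  calc _ ≤ ∫⁻ x in Metric.ball (0 : Para m) R, ‖ζ.re - x.1‖ₑ ^ (-(s - β)) *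
          (‖x.2‖ₑ ^ (-(n + n * (s - 1))) * ‖ζ.im - ‖x.2‖‖ₑ ^ (-β)) :=
        lintegral_mono fun x => weighted_rpow_le n ζ x (hc.trans hcβ.le) (hβ1.le.trans hs)
    _ = (∫⁻ t in Metric.ball 0 R, ‖ζ.re - t‖ₑ ^ (-(s - β))) *
          ∫⁻ v in Metric.ball (0 : Vec m) R,
            ‖v‖ₑ ^ (-(n + n * (s - 1))) * ‖ζ.im - ‖v‖‖ₑ ^ (-β) :=
        lintegral_ball_prod_mul _ _ R (f := fun t => ‖ζ.re - t‖ₑ ^ (-(s - β)))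
          (g := fun v => ‖v‖ₑ ^ (-(n + n * (s - 1))) * ‖ζ.im - ‖v‖‖ₑ ^ (-β))
          (by fun_prop) (by fun_prop)
    _ ≤ I * (C * ‖ζ.im‖ₑ ^ (-(n * (s - 1)))) :=
        mul_le_mul' (lintegral_ball_sub_left_le volume (fun t => ‖t‖ₑ ^ (-(s - β))) hre.le R)
          (h_radial ζ.im him himR)
    _ = _ := (mul_assoc _ _ _).symm

theorem enorm_inv_norm_pow_le {F : Type*} [SeminormedAddCommGroup F] (v : F) (n : ℕ) :
    ‖(‖v‖ ^ n)⁻¹‖ₑ ≤ ‖v‖ₑ ^ (-(n : ℝ)) := by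
  rw [ENNReal.rpow_neg, ENNReal.rpow_natCast]
  rcases eq_or_ne (‖v‖ ^ n) 0 with h | h
  · simp [h]
  · rw [enorm_inv h, enorm_pow, enorm_norm]

theorem natCast_mul_toReal_inv_lt_one {n : ℕ} {p : ℝ≥0∞} (h : (n : ℝ≥0∞) < p) :
    n * p⁻¹.toReal < 1 := by
  have h_lt : n * p⁻¹ < 1 := by
    rw [← div_eq_mul_inv]
    exact ENNReal.div_lt_of_lt_mul (by rwa [one_mul])
  simpa [-ENNReal.toReal_inv] using (ENNReal.toReal_lt_toReal h_lt.ne_top ENNReal.one_ne_top).2 h_lt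

theorem toReal_inv_conjugate (p q : ℝ≥0∞) [p.HolderConjugate q] :
    q⁻¹.toReal = 1 - p⁻¹.toReal := by
  have hp : p⁻¹ ≠ ⊤ := ENNReal.inv_ne_top.2 (ENNReal.HolderConjugate.ne_zero p q)
  have hq : q⁻¹ ≠ ⊤ := ENNReal.inv_ne_top.2 (ENNReal.HolderConjugate.ne_zero q p)
  rw [eq_sub_iff_add_eq', ← ENNReal.toReal_add hp hq,
    ENNReal.HolderConjugate.inv_add_inv_eq_one, ENNReal.toReal_one]

theorem IsCauchyType.enorm_weighted_le {F : ℂ → Para m → Cl m} (hF : IsCauchyType F) (n : ℕ)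
    (z : ℂ) (x : Para m) :
    ‖(‖x.2‖ ^ n)⁻¹ • F z x‖ₑ ≤
      2 * (‖x.2‖ₑ ^ (-(n : ℝ)) * ‖foldUpper z - halfPlane x‖ₑ⁻¹) :=
  calc _ = ‖(‖x.2‖ ^ n)⁻¹‖ₑ * ‖F z x‖ₑ := enorm_smul _ _
    _ ≤ ‖x.2‖ₑ ^ (-(n : ℝ)) * (2 * ‖foldUpper z - halfPlane x‖ₑ⁻¹) :=
      mul_le_mul' (enorm_inv_norm_pow_le x.2 n) (hF.enorm_le z x)
    _ = _ := mul_left_comm _ _ _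

theorem toReal_inv_mul_toReal_conjugate {p q : ℝ≥0∞} [p.HolderConjugate q] (hq : q ≠ ⊤) :
    p⁻¹.toReal * q.toReal = q.toReal - 1 := by
  have hq0 : q.toReal ≠ 0 := ENNReal.toReal_ne_zero.2 ⟨ENNReal.HolderConjugate.ne_zero q p, hq⟩
  have h : q.toReal⁻¹ = 1 - p⁻¹.toReal := by rw [← ENNReal.toReal_inv, toReal_inv_conjugate p q]
  linear_combination q.toReal * h - mul_inv_cancel₀ hq0

theorem conjugate_exponent_bounds (hm : 1 ≤ m) {p q : ℝ≥0∞} [p.HolderConjugate q]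
    (hp : max (m : ℝ≥0∞) 2 < p) :
    q ≠ ⊤ ∧ 1 ≤ q.toReal ∧ q.toReal < 2 ∧ (m - 1 : ℕ) * (q.toReal - 1) < 1 := by
  have hmt : m * p⁻¹.toReal < 1 := natCast_mul_toReal_inv_lt_one ((le_max_left _ _).trans_lt hp)
  have h2t : 2 * p⁻¹.toReal < 1 := natCast_mul_toReal_inv_lt_one ((le_max_right _ _).trans_lt hp)
  have hq : q ≠ ⊤ := by
    rintro rfl
    have h := toReal_inv_conjugate p ⊤
    rw [ENNReal.inv_top, ENNReal.toReal_zero] at h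
    linarith
  have hq0 : 0 < q.toReal := ENNReal.toReal_pos (ENNReal.HolderConjugate.ne_zero q p) hq
  have h_eq := toReal_inv_mul_toReal_conjugate (p := p) hq
  have h1 : 1 ≤ q.toReal := by
    linarith [mul_nonneg (ENNReal.toReal_nonneg : 0 ≤ p⁻¹.toReal) hq0.le]
  have h2 := mul_lt_mul_of_pos_right h2t hq0
  have h3 := mul_lt_mul_of_pos_right hmt hq0
  rw [mul_assoc, h_eq, one_mul] at h2 h3
  refine ⟨hq, h1, by linarith, ?_⟩
  rw [Nat.cast_pred hm]
  linarith

theorem exists_eLpNorm_weighted_le (hm : 1 ≤ m) {p q : ℝ≥0∞} [p.HolderConjugate q]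
    (hp : max (m : ℝ≥0∞) 2 < p) (R : ℝ) :
    ∃ C : ℝ≥0∞, C ≠ ⊤ ∧ ∀ F : ℂ → Para m → Cl m, IsCauchyType F →
      ∀ z : ℂ, |z.re| < R → z.im ≠ 0 → |z.im| < R →
        eLpNorm (fun x => (‖x.2‖ ^ (m - 1))⁻¹ • F z x) q (volume.restrict (Metric.ball 0 R)) ≤
          C * ‖z.im‖ₑ ^ (-((m - 1 : ℕ) * p⁻¹.toReal)) := by
  obtain ⟨hq, hs, hs2, hms⟩ := conjugate_exponent_bounds hm hp (q := q)
  have hst := toReal_inv_mul_toReal_conjugate (p := p) hq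
  set s := q.toReal
  have hs0 : s ≠ 0 := (one_pos.trans_le hs).ne'
  obtain ⟨C, hC, h_int⟩ := exists_lintegral_ball_weighted_le hm hs hs2 hms R
  refine ⟨2 * C ^ (1 / s), ENNReal.mul_ne_top ENNReal.ofNat_ne_top
    (ENNReal.rpow_ne_top_of_nonneg (by positivity) hC), fun F hF z hre him himR => ?_⟩
  let w (x : Para m) : ℝ≥0∞ := ‖x.2‖ₑ ^ (-((m - 1 : ℕ) : ℝ)) * ‖foldUpper z - halfPlane x‖ₑ⁻¹
  have hw : Measurable w := by
    have := continuous_halfPlane (m := m).measurable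
    fun_prop
  calc _ ≤ 2 * eLpNorm w q (volume.restrict (Metric.ball 0 R)) :=
        eLpNorm_le_mul_eLpNorm_of_ae_le_mul'' q hw.aestronglyMeasurable
          (.of_forall (hF.enorm_weighted_le (m - 1) z))
    _ = 2 * (∫⁻ x in Metric.ball 0 R, w x ^ s) ^ (1 / s) := by
        rw [eLpNorm_eq_lintegral_rpow_enorm_toReal (ENNReal.HolderConjugate.ne_zero q p) hq]
        simp_rw [enorm_eq_self]
        rfl
    _ ≤ 2 * (C * ‖|z.im|‖ₑ ^ (-((m - 1 : ℕ) * (s - 1)))) ^ (1 / s) := by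
        gcongr
        exact h_int (foldUpper z) hre (abs_pos.2 him) himR
    _ = _ := by
        rw [Real.enorm_abs, ENNReal.mul_rpow_of_nonneg _ _ (by positivity), ← ENNReal.rpow_mul,
          ← hst, mul_assoc]
        congr 3
        field_simp

/-! ### The domain -/

section Transform

variable {D : Set ℂ}

theorem exists_mem_unitSphere (hm : 1 ≤ m) : ∃ J, J ∈ unitSphere m :=
  ⟨EuclideanSpace.basisFun (Fin m) ℝ ⟨0, hm⟩, by simp⟩

theorem slicePoint_mem_Omega {J : Vec m} (hJ : J ∈ unitSphere m) {z : ℂ} (hz : z ∈ D) :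
    slicePoint J z ∈ Omega m D :=
  mem_biUnion hJ (mem_image_of_mem _ hz)

theorem mem_Omega_iff_exists {q : Para m} :
    q ∈ Omega m D ↔ ∃ J ∈ unitSphere m, ∃ z ∈ D, slicePoint J z = q := by
  simp only [Omega, mem_iUnion, mem_image, exists_prop]

theorem Omega_eq_preimage (hm : 1 ≤ m) (hconj : ∀ z ∈ D, starRingEnd ℂ z ∈ D) :
    Omega m D = halfPlane ⁻¹' D := by
  ext x
  rw [mem_Omega_iff_exists, mem_preimage]
  constructor
  · rintro ⟨J, hJ, z, hz, rfl⟩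
    rw [halfPlane_slicePoint hJ]
    rcases foldUpper_eq_or z with h | h <;> rw [h]
    exacts [hz, hconj z hz]
  · intro hx
    by_cases h : x.2 = 0
    · obtain ⟨J, hJ⟩ := exists_mem_unitSphere hm
      exact ⟨J, hJ, _, hx, Prod.ext rfl (by simp [slicePoint, halfPlane, h])⟩
    · exact ⟨_, inv_norm_smul_mem_unitSphere h, _, hx, slicePoint_halfPlane h⟩

theorem measurableSet_Omega (hm : 1 ≤ m) (hD : MeasurableSet D)
    (hconj : ∀ z ∈ D, starRingEnd ℂ z ∈ D) : MeasurableSet (Omega m D) := by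
  rw [Omega_eq_preimage hm hconj]
  exact hD.preimage continuous_halfPlane.measurable

theorem norm_slicePoint_snd {J : Vec m} (hJ : J ∈ unitSphere m) (z : ℂ) :
    ‖(slicePoint J z).2‖ = |z.im| := by
  rw [slicePoint, norm_smul, mem_sphere_zero_iff_norm.1 hJ, mul_one, Real.norm_eq_abs]

theorem abs_re_lt_and_abs_im_lt (hm : 1 ≤ m) {R : ℝ} (hR : Omega m D ⊆ Metric.ball 0 R) {z : ℂ}
    (hz : z ∈ D) : |z.re| < R ∧ |z.im| < R := by
  obtain ⟨J, hJ⟩ := exists_mem_unitSphere hm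
  have h := mem_ball_zero_iff.1 (hR (slicePoint_mem_Omega hJ hz))
  exact ⟨(norm_fst_le _).trans_lt h, norm_slicePoint_snd hJ z ▸ (norm_snd_le _).trans_lt h⟩

theorem im_ne_zero_of_mem (hm : 1 ≤ m) (hreal : ∀ x ∈ Omega m D, x.2 ≠ 0) {z : ℂ} (hz : z ∈ D) :
    z.im ≠ 0 := by
  obtain ⟨J, hJ⟩ := exists_mem_unitSphere hm
  exact fun h => hreal _ (slicePoint_mem_Omega hJ hz) (by simp [slicePoint, h])

/-! ### Convergence of the integrals -/

theorem IsCauchyType.stronglyMeasurable_weighted {F : ℂ → Para m → Cl m} (hF : IsCauchyType F)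
    (n : ℕ) : StronglyMeasurable fun y : ℂ × Para m => (‖y.2.2‖ ^ n)⁻¹ • F y.1 y.2 :=
  (by fun_prop : Measurable fun y : ℂ × Para m => (‖y.2.2‖ ^ n)⁻¹).stronglyMeasurable.smul
    hF.stronglyMeasurable

theorem IsCauchyType.stronglyMeasurable_weighted_apply {F : ℂ → Para m → Cl m}
    (hF : IsCauchyType F) (n : ℕ) (z : ℂ) :
    StronglyMeasurable fun x : Para m => (‖x.2‖ ^ n)⁻¹ • F z x := by
  have h := (hF.stronglyMeasurable_weighted n).comp_measurable (measurable_prodMk_left (x := z))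
  exact h

theorem exists_eLpNorm_weighted_Omega_le (hm : 1 ≤ m)
    (hbdd : Bornology.IsBounded (Omega m D)) (hreal : ∀ x ∈ Omega m D, x.2 ≠ 0) {p q : ℝ≥0∞}
    [p.HolderConjugate q] (hp : max (m : ℝ≥0∞) 2 < p) :
    ∃ C : ℝ≥0∞, C ≠ ⊤ ∧ ∀ F : ℂ → Para m → Cl m, IsCauchyType F → ∀ z ∈ D,
      eLpNorm (fun x => (‖x.2‖ ^ (m - 1))⁻¹ • F z x) q (volume.restrict (Omega m D)) ≤
        C * ‖z.im‖ₑ ^ (-((m - 1 : ℕ) * p⁻¹.toReal)) := by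
  obtain ⟨R, hR⟩ := hbdd.subset_ball 0
  obtain ⟨C, hC, h⟩ := exists_eLpNorm_weighted_le hm hp (q := q) R
  refine ⟨C, hC, fun F hF z hz => ?_⟩
  obtain ⟨hre, him⟩ := abs_re_lt_and_abs_im_lt hm hR hz
  exact (eLpNorm_mono_measure _ (Measure.restrict_mono_set _ hR)).trans
    (h F hF z hre (im_ne_zero_of_mem hm hreal hz) him)

theorem integrableOn_stemIntegrand (hm : 1 ≤ m) (hbdd : Bornology.IsBounded (Omega m D))
    (hreal : ∀ x ∈ Omega m D, x.2 ≠ 0) {p : ℝ≥0∞} (hp : max (m : ℝ≥0∞) 2 < p)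
    {F : ℂ → Para m → Cl m} (hF : IsCauchyType F) {f : Para m → Cl m}
    (hf : MemLp f p (volume.restrict (Omega m D))) {z : ℂ} (hz : z ∈ D) :
    IntegrableOn (fun x => (‖x.2‖ ^ (m - 1))⁻¹ • (F z x * f x)) (Omega m D) := by
  have hp1 : 1 ≤ p := ENNReal.one_lt_two.le.trans ((le_max_right _ _).trans hp.le)
  have := ENNReal.HolderConjugate.conjExponent hp1
  obtain ⟨C, hC, h⟩ := exists_eLpNorm_weighted_Omega_le hm hbdd hreal hp (q := p.conjExponent)
  have h_ne_top : ‖z.im‖ₑ ^ (-((m - 1 : ℕ) * p⁻¹.toReal)) ≠ ⊤ :=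
    ENNReal.rpow_ne_top_of_ne_zero (by simpa using im_ne_zero_of_mem hm hreal hz) enorm_ne_top
  have hw : MemLp (fun x => (‖x.2‖ ^ (m - 1))⁻¹ • F z x) p.conjExponent
      (volume.restrict (Omega m D)) :=
    ⟨(hF.stronglyMeasurable_weighted_apply _ z).aestronglyMeasurable,
      (h F hF z hz).trans_lt (ENNReal.mul_ne_top hC h_ne_top).lt_top⟩
  refine (memLp_one_iff_integrable.1 ((mulCLM m).memLp_of_bilin 1 hw hf)).congr
    (.of_forall fun x => ?_)
  exact smul_mul_assoc _ _ _

theorem lintegral_enorm_mul_le {α : Type*} {_ : MeasurableSpace α} {μ : Measure α} (q p : ℝ≥0∞)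
    [q.HolderConjugate p] {g f : α → Cl m} (hg : AEStronglyMeasurable g μ)
    (hf : AEStronglyMeasurable f μ) :
    ∫⁻ x, ‖g x * f x‖ₑ ∂μ ≤ ‖mulCLM m‖ₑ * eLpNorm g q μ * eLpNorm f p μ := by
  rw [← eLpNorm_one_eq_lintegral_enorm]
  exact eLpNorm_le_eLpNorm_mul_eLpNorm'_of_norm hg hf (· * ·) ‖mulCLM m‖₊
    (.of_forall fun x => (mulCLM m).le_opNorm₂ (g x) (f x))

theorem exists_enorm_stemTransform_le (hm : 1 ≤ m) (hbdd : Bornology.IsBounded (Omega m D))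
    (hreal : ∀ x ∈ Omega m D, x.2 ≠ 0) {p : ℝ≥0∞} (hp : max (m : ℝ≥0∞) 2 < p) :
    ∃ C : ℝ≥0∞, C ≠ ⊤ ∧ ∀ F : ℂ → Para m → Cl m, IsCauchyType F → ∀ f : Para m → Cl m,
      AEStronglyMeasurable f (volume.restrict (Omega m D)) → ∀ z ∈ D,
      ‖stemTransform F D f z‖ₑ ≤ C * ‖z.im‖ₑ ^ (-((m - 1 : ℕ) * p⁻¹.toReal)) *
        eLpNorm f p (volume.restrict (Omega m D)) := by
  have hp1 : 1 ≤ p := ENNReal.one_lt_two.le.trans ((le_max_right _ _).trans hp.le)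
  have := ENNReal.HolderConjugate.conjExponent hp1
  obtain ⟨C, hC, h⟩ := exists_eLpNorm_weighted_Omega_le hm hbdd hreal hp (q := p.conjExponent)
  refine ⟨‖-(1 / (Real.pi * sphereArea m))‖ₑ * (‖mulCLM m‖ₑ * C),
    ENNReal.mul_ne_top enorm_ne_top (ENNReal.mul_ne_top enorm_ne_top hC), fun F hF f hf z hz => ?_⟩
  have hw := (hF.stronglyMeasurable_weighted_apply (m - 1) z).aestronglyMeasurable
    (μ := volume.restrict (Omega m D))
  have h_bound := (lintegral_enorm_mul_le p.conjExponent p hw hf).trans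
    (mul_le_mul_left (mul_le_mul_right (h F hF z hz) _) _)
  simp_rw [smul_mul_assoc] at h_bound
  rw [← mul_assoc] at h_bound
  rw [stemTransform, enorm_smul, mul_assoc, mul_assoc, ← mul_assoc (‖mulCLM m‖ₑ * C)]
  exact mul_le_mul_right ((enorm_integral_le_lintegral_enorm _).trans h_bound) _

/-! ### The transform as a slice function -/

theorem kernel_slicePoint_mul {J : Vec m} (hJ : J ∈ unitSphere m) (z : ℂ) (x : Para m) (c : Cl m) :
    kernel (slicePoint J z) x * c = (2 / sphereArea m) •
      ((‖x.2‖ ^ (m - 1))⁻¹ • (kernelStem₁ z x * c) +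
        mulCLM m (vec J) ((‖x.2‖ ^ (m - 1))⁻¹ • (kernelStem₂ z x * c))) := by
  rw [mulCLM_apply, kernel, cauchyKernel_slicePoint hJ, smul_mul_assoc, add_mul, mul_smul_comm,
    ← smul_add, smul_smul, mul_assoc, div_mul_eq_div_mul_one_div, one_div]

theorem integrableOn_kernel_mul {f : Para m → Cl m} {z : ℂ}
    (h₁ : IntegrableOn (fun x => (‖x.2‖ ^ (m - 1))⁻¹ • (kernelStem₁ z x * f x)) (Omega m D))
    (h₂ : IntegrableOn (fun x => (‖x.2‖ ^ (m - 1))⁻¹ • (kernelStem₂ z x * f x)) (Omega m D))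
    {J : Vec m} (hJ : J ∈ unitSphere m) :
    IntegrableOn (fun x => kernel (slicePoint J z) x * f x) (Omega m D) := by
  simp_rw [kernel_slicePoint_mul hJ]
  exact (h₁.add ((mulCLM m (vec J)).integrable_comp h₂)).smul (2 / sphereArea m)

theorem teodorescu_slicePoint {f : Para m → Cl m} {z : ℂ}
    (h₁ : IntegrableOn (fun x => (‖x.2‖ ^ (m - 1))⁻¹ • (kernelStem₁ z x * f x)) (Omega m D))
    (h₂ : IntegrableOn (fun x => (‖x.2‖ ^ (m - 1))⁻¹ • (kernelStem₂ z x * f x)) (Omega m D))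
    {J : Vec m} (hJ : J ∈ unitSphere m) :
    teodorescu D f (slicePoint J z) =
      stemTransform kernelStem₁ D f z + vec J * stemTransform kernelStem₂ D f z := by
  have h_const : -(1 / (2 * Real.pi)) * (2 / sphereArea m) = -(1 / (Real.pi * sphereArea m)) := by
    ring
  simp_rw [teodorescu, kernel_slicePoint_mul hJ]
  rw [integral_smul, integral_add h₁ ((mulCLM m (vec J)).integrable_comp h₂),
    (mulCLM m (vec J)).integral_comp_comm h₂, smul_smul, h_const, smul_add, mulCLM_apply,
    ← mul_smul_comm, stemTransform, stemTransform]

theorem isStem_stemTransform (D : Set ℂ) (f : Para m → Cl m) :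
    IsStem D (stemTransform kernelStem₁ D f) (stemTransform kernelStem₂ D f) where
  even z _ := by simp_rw [stemTransform, kernelStem₁_conj]
  odd z _ := by simp_rw [stemTransform, kernelStem₂_conj, neg_mul, smul_neg, integral_neg, smul_neg]

theorem teodorescu_congr {f g : Para m → Cl m} (h : f =ᵐ[volume.restrict (Omega m D)] g)
    (q : Para m) : teodorescu D f q = teodorescu D g q :=
  congrArg _ (integral_congr_ae (h.mono fun x hx => congrArg (kernel q x * ·) hx))

theorem teodorescu_add {f g : Para m → Cl m} {q : Para m}
    (hf : IntegrableOn (fun x => kernel q x * f x) (Omega m D))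
    (hg : IntegrableOn (fun x => kernel q x * g x) (Omega m D)) :
    teodorescu D (f + g) q = teodorescu D f q + teodorescu D g q := by
  simp_rw [teodorescu, Pi.add_apply, mul_add]
  rw [integral_add hf hg, smul_add]

theorem teodorescu_smul (c : ℝ) (f : Para m → Cl m) (q : Para m) :
    teodorescu D (c • f) q = c • teodorescu D f q := by
  simp_rw [teodorescu, Pi.smul_apply, mul_smul_comm]
  rw [integral_smul, smul_comm]

theorem integrableOn_kernel (hm : 1 ≤ m) (hbdd : Bornology.IsBounded (Omega m D))
    (hreal : ∀ x ∈ Omega m D, x.2 ≠ 0) {p : ℝ≥0∞} (hp : max (m : ℝ≥0∞) 2 < p) {f : Para m → Cl m}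
    (hf : MemLp f p (volume.restrict (Omega m D))) {q : Para m} (hq : q ∈ Omega m D) :
    IntegrableOn (fun x => kernel q x * f x) (Omega m D) := by
  obtain ⟨J, hJ, z, hz, rfl⟩ := mem_Omega_iff_exists.1 hq
  exact integrableOn_kernel_mul
    (integrableOn_stemIntegrand hm hbdd hreal hp isCauchyType_kernelStem₁ hf hz)
    (integrableOn_stemIntegrand hm hbdd hreal hp isCauchyType_kernelStem₂ hf hz) hJ

theorem induces_teodorescu (hm : 1 ≤ m) (hbdd : Bornology.IsBounded (Omega m D))
    (hreal : ∀ x ∈ Omega m D, x.2 ≠ 0) {p : ℝ≥0∞} (hp : max (m : ℝ≥0∞) 2 < p) {f : Para m → Cl m}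
    (hf : MemLp f p (volume.restrict (Omega m D))) :
    Induces D (stemTransform kernelStem₁ D f) (stemTransform kernelStem₂ D f)
      (teodorescu D f) := fun _ hz _ hJ =>
  teodorescu_slicePoint
    (integrableOn_stemIntegrand hm hbdd hreal hp isCauchyType_kernelStem₁ hf hz)
    (integrableOn_stemIntegrand hm hbdd hreal hp isCauchyType_kernelStem₂ hf hz) hJ

/-! ### Boundedness on `L^p` -/

theorem IsCauchyType.stronglyMeasurable_stemTransform {F : ℂ → Para m → Cl m}
    (hF : IsCauchyType F) (D : Set ℂ) {f : Para m → Cl m} (hf : StronglyMeasurable f) :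
    StronglyMeasurable (stemTransform F D f) := by
  have h := ((hF.stronglyMeasurable_weighted (m - 1)).mul
    (hf.comp_measurable measurable_snd)).integral_prod_right' (ν := volume.restrict (Omega m D))
  simp only [Pi.mul_apply, smul_mul_assoc] at h
  exact h.const_smul (-(1 / (Real.pi * sphereArea m)))

theorem aestronglyMeasurable_teodorescu (hm : 1 ≤ m) (hD : MeasurableSet D)
    (hconj : ∀ z ∈ D, starRingEnd ℂ z ∈ D) (hbdd : Bornology.IsBounded (Omega m D))
    (hreal : ∀ x ∈ Omega m D, x.2 ≠ 0) {p : ℝ≥0∞} (hp : max (m : ℝ≥0∞) 2 < p)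
    {f : Para m → Cl m} (hf : MemLp f p (volume.restrict (Omega m D))) :
    AEStronglyMeasurable (teodorescu D f) (volume.restrict (Omega m D)) := by
  obtain ⟨g, hg, hfg⟩ := hf.1
  rw [funext (teodorescu_congr hfg)]
  have hz := (continuous_halfPlane (m := m)).measurable
  have h_meas : StronglyMeasurable fun q : Para m =>
      stemTransform kernelStem₁ D g (halfPlane q) +
        vec (‖q.2‖⁻¹ • q.2) * stemTransform kernelStem₂ D g (halfPlane q) :=
    ((isCauchyType_kernelStem₁.stronglyMeasurable_stemTransform D hg).comp_measurable hz).add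
      ((continuous_vec.comp_stronglyMeasurable (by fun_prop : Measurable fun q : Para m =>
        ‖q.2‖⁻¹ • q.2).stronglyMeasurable).mul
      ((isCauchyType_kernelStem₂.stronglyMeasurable_stemTransform D hg).comp_measurable hz))
  refine h_meas.aestronglyMeasurable.congr ?_
  filter_upwards [ae_restrict_mem (measurableSet_Omega hm hD hconj)] with q hq
  have hqD : halfPlane q ∈ D := by rwa [Omega_eq_preimage hm hconj] at hq
  rw [← induces_teodorescu hm hbdd hreal hp (hf.ae_eq hfg) _ hqD _
    (inv_norm_smul_mem_unitSphere (hreal q hq)), slicePoint_halfPlane (hreal q hq)]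

theorem exists_enorm_teodorescu_le (hm : 1 ≤ m) (hbdd : Bornology.IsBounded (Omega m D))
    (hreal : ∀ x ∈ Omega m D, x.2 ≠ 0) {p : ℝ≥0∞} (hp : max (m : ℝ≥0∞) 2 < p) :
    ∃ C : ℝ≥0∞, C ≠ ⊤ ∧ ∀ f : Para m → Cl m, MemLp f p (volume.restrict (Omega m D)) →
      ∀ q ∈ Omega m D, ‖teodorescu D f q‖ₑ ≤
        C * ‖q.2‖ₑ ^ (-((m - 1 : ℕ) * p⁻¹.toReal)) *
          eLpNorm f p (volume.restrict (Omega m D)) := by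
  obtain ⟨C, hC, h⟩ := exists_enorm_stemTransform_le hm hbdd hreal hp
  refine ⟨(1 + ‖mulCLM m‖ₑ) * C,
    ENNReal.mul_ne_top (ENNReal.add_ne_top.2 ⟨ENNReal.one_ne_top, enorm_ne_top⟩) hC,
    fun f hf q hq => ?_⟩
  obtain ⟨J, hJ, z, hz, rfl⟩ := mem_Omega_iff_exists.1 hq
  have h_im : ‖(slicePoint J z).2‖ₑ = ‖z.im‖ₑ := by
    rw [← ofReal_norm, norm_slicePoint_snd hJ, Real.enorm_eq_ofReal_abs]
  have h_vec : ‖(vec J : Cl m)‖ₑ = 1 := by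
    rw [← ofReal_norm, norm_vec, mem_sphere_zero_iff_norm.1 hJ, ENNReal.ofReal_one]
  have h_mul := enorm_mul_le (vec J) (stemTransform kernelStem₂ D f z)
  rw [h_vec, mul_one] at h_mul
  rw [induces_teodorescu hm hbdd hreal hp hf z hz J hJ, h_im]
  calc _ ≤ ‖stemTransform kernelStem₁ D f z‖ₑ +
          ‖mulCLM m‖ₑ * ‖stemTransform kernelStem₂ D f z‖ₑ :=
        (enorm_add_le _ _).trans (add_le_add_right h_mul _)
    _ ≤ _ := add_le_add (h _ isCauchyType_kernelStem₁ f hf.1 z hz)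
        (mul_le_mul_right (h _ isCauchyType_kernelStem₂ f hf.1 z hz) _)
    _ = _ := by ring

theorem eLpNorm_enorm_snd_rpow_lt_top (hm : 1 ≤ m) {α : ℝ} (hα : α < m) (p : ℝ≥0∞) (R : ℝ) :
    eLpNorm (fun x : Para m => ‖x.2‖ₑ ^ (-(α * p⁻¹.toReal))) p
      (volume.restrict (Metric.ball 0 R)) < ⊤ := by
  have : Nontrivial (Vec m) := Module.nontrivial_of_finrank_pos (R := ℝ)
    (by rwa [finrank_euclideanSpace_fin])
  rcases eq_or_ne p 0 with rfl | hp0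
  · simp
  rcases eq_or_ne p ⊤ with rfl | hp
  · have h_one : (fun x : Para m => ‖x.2‖ₑ ^ (-(α * (⊤ : ℝ≥0∞)⁻¹.toReal))) = fun _ => 1 := by simp
    rw [h_one]
    exact (memLp_top_const_enorm ENNReal.one_ne_top).2
  have h_rpow (x : Para m) : (‖x.2‖ₑ ^ (-(α * p⁻¹.toReal))) ^ p.toReal = 1 * ‖x.2‖ₑ ^ (-α) := by
    rw [← ENNReal.rpow_mul, one_mul, neg_mul, ENNReal.toReal_inv,
      inv_mul_cancel_right₀ (ENNReal.toReal_pos hp0 hp).ne']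
  rw [eLpNorm_lt_top_iff_lintegral_rpow_enorm_lt_top hp0 hp]
  simp_rw [enorm_eq_self, h_rpow]
  rw [Measure.volume_eq_prod, lintegral_ball_prod_mul volume volume R (f := fun _ => 1)
    (g := fun v => ‖v‖ₑ ^ (-α)) measurable_const (by fun_prop)]
  exact ENNReal.mul_lt_top (by rw [setLIntegral_one]; exact measure_ball_lt_top)
    (lintegral_ball_enorm_rpow_lt_top volume (by rwa [finrank_euclideanSpace_fin]) R)

theorem exists_eLpNorm_teodorescu_le (hm : 1 ≤ m) (hD : MeasurableSet D)
    (hconj : ∀ z ∈ D, starRingEnd ℂ z ∈ D) (hbdd : Bornology.IsBounded (Omega m D))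
    (hreal : ∀ x ∈ Omega m D, x.2 ≠ 0) {p : ℝ≥0∞} (hp : max (m : ℝ≥0∞) 2 < p) :
    ∃ C : ℝ≥0∞, C ≠ ⊤ ∧ ∀ f : Para m → Cl m, MemLp f p (volume.restrict (Omega m D)) →
      eLpNorm (teodorescu D f) p (volume.restrict (Omega m D)) ≤
        C * eLpNorm f p (volume.restrict (Omega m D)) := by
  obtain ⟨R, hR⟩ := hbdd.subset_ball 0
  obtain ⟨C, hC, h⟩ := exists_enorm_teodorescu_le hm hbdd hreal hp
  let w (x : Para m) : ℝ≥0∞ := ‖x.2‖ₑ ^ (-((m - 1 : ℕ) * p⁻¹.toReal))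
  have hw : Measurable w := by fun_prop
  have hw_top : eLpNorm w p (volume.restrict (Omega m D)) < ⊤ :=
    (eLpNorm_mono_measure _ (Measure.restrict_mono_set _ hR)).trans_lt
      (eLpNorm_enorm_snd_rpow_lt_top hm (Nat.cast_lt.2 (Nat.pred_lt_of_lt hm)) p R)
  refine ⟨C * eLpNorm w p (volume.restrict (Omega m D)), ENNReal.mul_ne_top hC hw_top.ne,
    fun f hf => ?_⟩
  rw [mul_right_comm]
  refine eLpNorm_le_mul_eLpNorm_of_ae_le_mul'' p hw.aestronglyMeasurable ?_
  filter_upwards [ae_restrict_mem (measurableSet_Omega hm hD hconj)] with q hq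
  exact (h f hf q hq).trans_eq (mul_right_comm _ _ _)

/-! ### The transform as an operator -/

theorem exists_continuousLinearMap_ae_eq {𝕜 V α E : Type*} [NormedField 𝕜]
    [SeminormedAddCommGroup V] [NormedSpace 𝕜 V] [NormedAddCommGroup E] [NormedSpace 𝕜 E]
    {_ : MeasurableSpace α} {μ : Measure α} {p : ℝ≥0∞} [Fact (1 ≤ p)] (T : V → α → E)
    (h_add : ∀ f g, T (f + g) =ᵐ[μ] T f + T g) (h_smul : ∀ (c : 𝕜) f, T (c • f) =ᵐ[μ] c • T f)
    (h_meas : ∀ f, AEStronglyMeasurable (T f) μ) {C : ℝ≥0∞} (hC : C ≠ ⊤)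
    (h_le : ∀ f, eLpNorm (T f) p μ ≤ C * ‖f‖ₑ) :
    ∃ S : V →L[𝕜] Lp E p μ, ∀ f, S f =ᵐ[μ] T f := by
  have h_mem (f : V) : MemLp (T f) p μ :=
    ⟨h_meas f, (h_le f).trans_lt (ENNReal.mul_lt_top hC.lt_top enorm_lt_top)⟩
  let S : V →ₗ[𝕜] Lp E p μ :=
    { toFun := fun f => (h_mem f).toLp
      map_add' := fun f g =>
        (MemLp.toLp_congr _ ((h_mem f).add (h_mem g)) (h_add f g)).trans (MemLp.toLp_add _ _)
      map_smul' := fun c f =>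
        (MemLp.toLp_congr _ ((h_mem f).const_smul c) (h_smul c f)).trans
          (MemLp.toLp_const_smul c _) }
  refine ⟨S.mkContinuous C.toReal fun f => ?_, fun f => (h_mem f).coeFn_toLp⟩
  change ‖(h_mem f).toLp‖ ≤ C.toReal * ‖f‖
  rw [Lp.norm_toLp, ← toReal_enorm f, ← ENNReal.toReal_mul]
  exact ENNReal.toReal_mono (ENNReal.mul_ne_top hC enorm_ne_top) (h_le f)

theorem exists_continuousLinearMap_teodorescu (hm : 1 ≤ m) (hD : MeasurableSet D)
    (hconj : ∀ z ∈ D, starRingEnd ℂ z ∈ D) (hbdd : Bornology.IsBounded (Omega m D))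
    (hreal : ∀ x ∈ Omega m D, x.2 ≠ 0) {p : ℝ≥0∞} [Fact (1 ≤ p)] (hp : max (m : ℝ≥0∞) 2 < p) :
    ∃ T : Lp (Cl m) p (volume.restrict (Omega m D)) →L[ℝ] Lp (Cl m) p (volume.restrict (Omega m D)),
      ∀ f, T f =ᵐ[volume.restrict (Omega m D)] teodorescu D f := by
  obtain ⟨C, hC, h_le⟩ := exists_eLpNorm_teodorescu_le hm hD hconj hbdd hreal hp
  refine exists_continuousLinearMap_ae_eq
    (fun f : Lp (Cl m) p (volume.restrict (Omega m D)) => teodorescu D f) (fun f g => ?_)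
    (fun c f => .of_forall fun q => ?_)
    (fun f => aestronglyMeasurable_teodorescu hm hD hconj hbdd hreal hp (Lp.memLp f)) hC
    fun f => (h_le f (Lp.memLp f)).trans_eq (by rw [Lp.enorm_def])
  · filter_upwards [ae_restrict_mem (measurableSet_Omega hm hD hconj)] with q hq
    rw [teodorescu_congr (Lp.coeFn_add f g), Pi.add_apply]
    exact teodorescu_add (integrableOn_kernel hm hbdd hreal hp (Lp.memLp f) hq)
      (integrableOn_kernel hm hbdd hreal hp (Lp.memLp g) hq)
  · rw [teodorescu_congr (Lp.coeFn_smul c f), teodorescu_smul, Pi.smul_apply]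

end Transform

end SliceClifford

end

open SliceClifford in
theorem mainTheorem5_general (m : ℕ) (hm : 1 ≤ m) (D : Set ℂ) (hD : MeasurableSet D)
    (hconj : ∀ z ∈ D, starRingEnd ℂ z ∈ D) (hbdd : Bornology.IsBounded (Omega m D))
    (hreal : ∀ x ∈ Omega m D, x.2 ≠ 0) (p : ℝ≥0∞) [Fact (1 ≤ p)] (hp : max (m : ℝ≥0∞) 2 < p) :
    (∀ x : Para m,
      IsStem (D \ {z | charPoly z x = 0}) (fun z => kernelStem₁ z x) (fun z => kernelStem₂ z x) ∧
      Induces (D \ {z | charPoly z x = 0}) (fun z => kernelStem₁ z x) (fun z => kernelStem₂ z x)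
        (fun q => cauchyKernel q x)) ∧
    (∀ f : Lp (Cl m) p (volume.restrict (Omega m D)),
      (∀ q ∈ Omega m D, IntegrableOn (fun x => kernel q x * f x) (Omega m D)) ∧
      (∀ z ∈ D,
        IntegrableOn (fun x => (‖x.2‖ ^ (m - 1))⁻¹ • (kernelStem₁ z x * f x)) (Omega m D) ∧
        IntegrableOn (fun x => (‖x.2‖ ^ (m - 1))⁻¹ • (kernelStem₂ z x * f x)) (Omega m D)) ∧
      IsStem D (stemTransform kernelStem₁ D f) (stemTransform kernelStem₂ D f) ∧
      Induces D (stemTransform kernelStem₁ D f) (stemTransform kernelStem₂ D f)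
        (teodorescu D f)) ∧
    (∃ T : Lp (Cl m) p (volume.restrict (Omega m D)) →L[ℝ] sliceLp m D p,
      ∀ f, (T f).1 =ᵐ[volume.restrict (Omega m D)] teodorescu D f) := by
  obtain ⟨T, hT⟩ := exists_continuousLinearMap_teodorescu hm hD hconj hbdd hreal hp
  have h_stem {F : ℂ → Para m → Cl m} (hF : IsCauchyType F)
      (f : Lp (Cl m) p (volume.restrict (Omega m D))) {z : ℂ} (hz : z ∈ D) :=
    integrableOn_stemIntegrand hm hbdd hreal hp hF (Lp.memLp f) hz
  have h_ind (f : Lp (Cl m) p (volume.restrict (Omega m D))) :=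
    induces_teodorescu hm hbdd hreal hp (Lp.memLp f)
  exact ⟨fun x => ⟨isStem_kernelStem _ x, induces_cauchyKernel _ x⟩,
    fun f => ⟨fun q hq => integrableOn_kernel hm hbdd hreal hp (Lp.memLp f) hq,
      fun z hz => ⟨h_stem isCauchyType_kernelStem₁ f hz, h_stem isCauchyType_kernelStem₂ f hz⟩,
      isStem_stemTransform D f, h_ind f⟩,
    T.codRestrict _ fun f => ⟨_, ⟨_, _, isStem_stemTransform D f, h_ind f⟩, hT f⟩, hT⟩

theorem mainTheorem5 (m : ℕ) (hm : 1 ≤ m) (D : Set ℂ) (hD : IsOpen D)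
    (hconj : ∀ z ∈ D, starRingEnd ℂ z ∈ D)
    (hbdd : Bornology.IsBounded (SliceClifford.Omega m D))
    (hreal : ∀ x ∈ SliceClifford.Omega m D, x.2 ≠ 0)
    (p : ℝ≥0∞) [Fact (1 ≤ p)] (hp : max (m : ℝ≥0∞) 2 < p) (hp' : p ≠ ∞) :
    -- the slice Cauchy kernel is, in its first variable, induced by an explicit stem function
    (∀ x ∈ SliceClifford.Omega m D,
      SliceClifford.IsStem (D \ {z | SliceClifford.charPoly z x = 0})
        (fun z => SliceClifford.kernelStem₁ z x) (fun z => SliceClifford.kernelStem₂ z x) ∧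
      SliceClifford.Induces (D \ {z | SliceClifford.charPoly z x = 0})
        (fun z => SliceClifford.kernelStem₁ z x) (fun z => SliceClifford.kernelStem₂ z x)
        (fun q => SliceClifford.cauchyKernel q x)) ∧
    -- the integrals that define the transform and its stem function converge, and the stem
    -- function induces the transform
    (∀ f : SliceClifford.sliceLp m D p,
      (∀ q ∈ SliceClifford.Omega m D,
        IntegrableOn (fun x => SliceClifford.kernel q x * f.1 x) (SliceClifford.Omega m D)) ∧
      (∀ z ∈ D,
        IntegrableOn (fun x => (‖x.2‖ ^ (m - 1))⁻¹ • (SliceClifford.kernelStem₁ z x * f.1 x))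
          (SliceClifford.Omega m D) ∧
        IntegrableOn (fun x => (‖x.2‖ ^ (m - 1))⁻¹ • (SliceClifford.kernelStem₂ z x * f.1 x))
          (SliceClifford.Omega m D)) ∧
      SliceClifford.IsStem D
        (SliceClifford.stemTransform SliceClifford.kernelStem₁ D f.1)
        (SliceClifford.stemTransform SliceClifford.kernelStem₂ D f.1) ∧
      SliceClifford.Induces D
        (SliceClifford.stemTransform SliceClifford.kernelStem₁ D f.1)
        (SliceClifford.stemTransform SliceClifford.kernelStem₂ D f.1)
        (SliceClifford.teodorescu D f.1)) ∧
    -- the transform is a continuous map of the space of slice `L^p` functions to itself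
    (∃ T : SliceClifford.sliceLp m D p →L[ℝ] SliceClifford.sliceLp m D p,
      ∀ f : SliceClifford.sliceLp m D p,
        (T f).1 =ᵐ[volume.restrict (SliceClifford.Omega m D)] SliceClifford.teodorescu D f.1) := by
  obtain ⟨h_kernel, h_transform, T, hT⟩ :=
    mainTheorem5_general m hm D hD.measurableSet hconj hbdd hreal p hp
  exact ⟨fun x _ => h_kernel x, fun f => h_transform f.1,
    T.comp (SliceClifford.sliceLp m D p).subtypeL, fun f => hT f.1⟩
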